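/- In the 2D Demand Bin Packing problem we are given numbers $T, C \in \mathbb{N}$ (each bin is a timeline with $T$ time slots, each of capacity $C$) and $n$ tasks, where task $i$ has a height $h_i \in \mathbb{N}$ and a width $w_i \in \mathbb{N}$ with $w_i \le T$. A solution assigns every task $i$ to a bin and to a starting slot $t_i \in \{1,\dots,T-w_i+1\}$ in that bin, so that the task places load $h_i$ into each of the slots $t_i,\dots,t_i+w_i-1$ of its bin; it is feasible if in every bin the total load of every slot is at most $C$. Let $OPT$ be the minimum number of bins of a feasible solution. Theorem. There is a polynomial-time $2$-approximation algorithm for 2D Demand Bin Packing for short tasks. That is, there are an algorithm (a fixed program for a random access machine with addition, subtraction, comparison and indirect addressing at unit cost) and a polynomial $q$ such that, for every instance with $h_i \le \frac{1}{9}C$ for all $i$, the algorithm halts after at most $q(N)$ steps, where $N$ is the length of the binary encoding of the instance, and outputs a feasible solution (a bin and a starting slot for each task) that uses at most $2\cdot OPT$ bins. -/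

import Mathlib

/-! ### The 2D Demand Bin Packing problem -/

namespace DemandBinPacking

/-- An instance: bins with `T` time slots of capacity `C`, and `n` tasks with heights and widths. -/
structure Instance where
  T : ℕ
  C : ℕ
  n : ℕ
  height : Fin n → ℕ
  width : Fin n → ℕ

namespace Instance

variable (I : Instance)

/-- The total load that the tasks of `S`, started at the slots given by `A`, place into slot `t`. -/
def load (S : Finset (Fin I.n)) (A : Fin I.n → ℕ) (t : ℕ) : ℕ :=
  ∑ i ∈ S with A i ≤ t ∧ t < A i + I.width i, I.height i

/-- `A` is a feasible allocation of the tasks of `S` into one bin. The time slots are numbered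
`0, …, T - 1`; each task has to end within the timeline. -/
def FeasibleAllocation (S : Finset (Fin I.n)) (A : Fin I.n → ℕ) : Prop :=
  (∀ i ∈ S, A i + I.width i ≤ I.T) ∧ ∀ t < I.T, I.load S A t ≤ I.C

/-- A candidate solution: a number of bins and, for each task, its bin and its first slot. -/
structure Solution where
  bins : ℕ
  bin : Fin I.n → ℕ
  start : Fin I.n → ℕ

/-- Every task lies in one of the bins, and each bin carries a feasible allocation. -/
def Solution.Feasible {I : Instance} (s : I.Solution) : Prop :=
  (∀ i, s.bin i < s.bins) ∧
    ∀ j < s.bins, I.FeasibleAllocation {i | s.bin i = j} s.start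

/-- The least number of bins of a feasible solution. -/
noncomputable def OPT : ℕ :=
  sInf {m | ∃ s : I.Solution, s.Feasible ∧ s.bins = m}

/-- Every single task fits into an empty bin as far as its width is concerned. -/
def WidthsFit : Prop := ∀ i, I.width i ≤ I.T

/-- All tasks have height at most `C / 9`. -/
def Short : Prop := ∀ i, 9 * I.height i ≤ I.C

/-- `OPT` is attained for the instances of interest: one bin per task is feasible. -/
theorem exists_feasible_bins_eq_OPT (hw : I.WidthsFit) (hh : I.Short) :
    ∃ s : I.Solution, s.Feasible ∧ s.bins = I.OPT := by
  refine Nat.sInf_mem (s := {m | ∃ s : I.Solution, s.Feasible ∧ s.bins = m})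
    ⟨I.n, ⟨I.n, fun i => i, fun _ => 0⟩, ⟨fun i => i.2, fun j hj => ⟨fun i _ => ?_, fun t _ => ?_⟩⟩,
      rfl⟩
  · simpa using hw i
  · have h9 := hh ⟨j, hj⟩
    refine le_trans (Finset.sum_le_sum_of_subset (t := {⟨j, hj⟩}) ?_) ?_
    · intro i hi
      simp only [Finset.mem_filter, Finset.mem_univ, true_and] at hi
      simp [Fin.ext_iff, hi.1]
    · rw [Finset.sum_singleton]
      omega

end Instance

/-! ### Random access machines

A RAM with registers `r₀, r₁, …` and an unbounded memory, all holding natural numbers. Each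
elementary instruction and each test costs one unit of time. There is no multiplication, so that
a number gains at most one bit per instruction and unit cost is polynomially related to the cost
on a Turing machine. -/

/-- A state of the machine. -/
structure State where
  reg : ℕ → ℕ
  mem : ℕ → ℕ

/-- Elementary instructions; the arguments name registers, except for the constant `c`. -/
inductive Instr where
  /-- `r_d := c` -/
  | const (d c : ℕ)
  /-- `r_d := r_a` -/
  | move (d a : ℕ)
  /-- `r_d := r_a + r_b` -/
  | add (d a b : ℕ)
  /-- `r_d := max (r_a - r_b) 0` -/
  | sub (d a b : ℕ)
  /-- `r_d := mem[r_a]` -/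
  | load (d a : ℕ)
  /-- `mem[r_a] := r_b` -/
  | store (a b : ℕ)

/-- The effect of an elementary instruction. -/
def Instr.exec : Instr → State → State
  | .const d c, s => { s with reg := Function.update s.reg d c }
  | .move d a, s => { s with reg := Function.update s.reg d (s.reg a) }
  | .add d a b, s => { s with reg := Function.update s.reg d (s.reg a + s.reg b) }
  | .sub d a b, s => { s with reg := Function.update s.reg d (s.reg a - s.reg b) }
  | .load d a, s => { s with reg := Function.update s.reg d (s.mem (s.reg a)) }
  | .store a b, s => { s with mem := Function.update s.mem (s.reg a) (s.reg b) }

/-- Programs: `branch a b p q` is "if `r_a < r_b` then `p` else `q`", and `loop a b p` is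
"while `r_a < r_b` do `p`". -/
inductive Program where
  | skip
  | instr (i : Instr)
  | seq (p q : Program)
  | branch (a b : ℕ) (p q : Program)
  | loop (a b : ℕ) (p : Program)

/-- `Runs p s k s'`: started in state `s`, the program `p` halts in state `s'` after exactly `k`
units of time. -/
inductive Runs : Program → State → ℕ → State → Prop
  | skip (s : State) : Runs .skip s 0 s
  | instr (i : Instr) (s : State) : Runs (.instr i) s 1 (i.exec s)
  | seq {p q : Program} {s s' s'' : State} {k l : ℕ} :
      Runs p s k s' → Runs q s' l s'' → Runs (.seq p q) s (k + l) s''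
  | branch_true {a b : ℕ} {p q : Program} {s s' : State} {k : ℕ} :
      s.reg a < s.reg b → Runs p s k s' → Runs (.branch a b p q) s (k + 1) s'
  | branch_false {a b : ℕ} {p q : Program} {s s' : State} {k : ℕ} :
      ¬ s.reg a < s.reg b → Runs q s k s' → Runs (.branch a b p q) s (k + 1) s'
  | loop_true {a b : ℕ} {p : Program} {s s' s'' : State} {k l : ℕ} :
      s.reg a < s.reg b → Runs p s k s' → Runs (.loop a b p) s' l s'' →
        Runs (.loop a b p) s (k + l + 1) s''
  | loop_false {a b : ℕ} {p : Program} {s : State} :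
      ¬ s.reg a < s.reg b → Runs (.loop a b p) s 1 s

/-- The machine is deterministic. -/
theorem Runs.deterministic {p : Program} {s s₁ : State} {k₁ : ℕ} (h₁ : Runs p s k₁ s₁) :
    ∀ {k₂ : ℕ} {s₂ : State}, Runs p s k₂ s₂ → k₁ = k₂ ∧ s₁ = s₂ := by
  induction h₁ with
  | skip s => intro k₂ s₂ h₂; cases h₂; exact ⟨rfl, rfl⟩
  | instr i s => intro k₂ s₂ h₂; cases h₂; exact ⟨rfl, rfl⟩
  | seq _ _ ih ih' =>
    intro k₂ s₂ h₂
    cases h₂ with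
    | seq g g' =>
      obtain ⟨rfl, rfl⟩ := ih g
      obtain ⟨rfl, rfl⟩ := ih' g'
      exact ⟨rfl, rfl⟩
  | branch_true hc _ ih =>
    intro k₂ s₂ h₂
    cases h₂ with
    | branch_true _ g => obtain ⟨rfl, rfl⟩ := ih g; exact ⟨rfl, rfl⟩
    | branch_false hn _ => exact absurd hc hn
  | branch_false hn _ ih =>
    intro k₂ s₂ h₂
    cases h₂ with
    | branch_true hc _ => exact absurd hc hn
    | branch_false _ g => obtain ⟨rfl, rfl⟩ := ih g; exact ⟨rfl, rfl⟩
  | loop_true hc _ _ ih ih' =>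
    intro k₂ s₂ h₂
    cases h₂ with
    | loop_true _ g g' =>
      obtain ⟨rfl, rfl⟩ := ih g
      obtain ⟨rfl, rfl⟩ := ih' g'
      exact ⟨rfl, rfl⟩
    | loop_false hn => exact absurd hc hn
  | loop_false hn =>
    intro k₂ s₂ h₂
    cases h₂ with
    | loop_true hc _ _ => exact absurd hc hn
    | loop_false _ => exact ⟨rfl, rfl⟩

/-! ### Input and output of algorithms for the problem -/

namespace Instance

variable (I : Instance)

/-- The instance as a list of numbers: `T, C, n`, then all heights, then all widths. -/
def inputList : List ℕ :=
  [I.T, I.C, I.n] ++ List.ofFn I.height ++ List.ofFn I.width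

/-- The length of the binary encoding of the instance, with one separator per number. -/
def inputSize : ℕ := (I.inputList.map fun x => Nat.size x + 1).sum

/-- The initial state: the instance is in memory, from address `0` on; everything else is `0`. -/
def initialState : State where
  reg := fun _ => 0
  mem := fun a => I.inputList.getD a 0

/-- The solution read off a final state: address `0` holds the number of bins, the next `n`
addresses the bins of the tasks, the following `n` addresses their first slots. -/
def outputSolution (s : State) : I.Solution where
  bins := s.mem 0
  bin := fun i => s.mem (1 + (i : ℕ))
  start := fun i => s.mem (1 + I.n + (i : ℕ))

end Instance

/-- `p` is a polynomial-time `α`-approximation algorithm for the instances in the class `P`: with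
a running time bounded by a fixed polynomial in the length of the input, it outputs a feasible
solution that uses at most `α * OPT` bins. -/
def IsPolyTimeApprox (α : ℕ) (P : Instance → Prop) (p : Program) : Prop :=
  ∃ q : Polynomial ℕ, ∀ I : Instance, P I →
    ∃ (k : ℕ) (s : State), Runs p I.initialState k s ∧ k ≤ q.eval I.inputSize ∧
      (I.outputSolution s).Feasible ∧ (I.outputSolution s).bins ≤ α * I.OPT

end DemandBinPacking

/-! The algorithm is first fit over bins, in three width classes: wider than `T/2`, then between
`7T/16` and `T/2`, then the rest. Inside a bin a task starts at the first slot `x` from which on the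
tasks that have not ended (`late`) leave room for it; it goes to the next bin if it would then end
after `T`. Since `late` only decreases in time and bounds the load, the capacity is respected.
Before `x` every slot has load above `C - C/9 = 8C/9` (`Good.lt_load`), and `GoodBin` preserves this
profile.

Suppose every open bin refuses a task of width `w`. Then the slots `0, …, T - w` of each bin carry
load above `8C/9`. If `w ≤ 7T/16`, the covered area exceeds `(9/16)(8/9)TC = TC/2` per bin
(`Good.lt_area`), whereas a feasible bin has area at most `TC`. If `w > 7T/16`, the packed tasks
belong to the same class or a wider one; with the weights of `weight`, each bin has weight above
`16C/9` (`Good.lt_sum_weight`), whereas a feasible bin has weight at most `3C`, and `27/16 < 2`.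
Either way fewer than `2 * OPT` bins are open (`Good.bins_lt`), so one more may be opened.

For the running time, the first slot with room is `0` or the end of a task
(`IsFirstRoom.eq_finish`). The search therefore runs over tasks and not over the `T` slots, whose
number may be exponential in the input length. The nested loops take `O(n⁴)` steps. -/

namespace DemandBinPacking

namespace Instance

variable {I : Instance}

/-! ### Lower bounds on the number of bins -/

/-- The total area of the tasks of `S`. -/
def area (I : Instance) (S : Finset (Fin I.n)) : ℕ := ∑ i ∈ S, I.height i * I.width i

/-- Tasks wider than `7T/16` count with their height, tasks wider than `T/2` with twice their
height. -/
def weight (I : Instance) (i : Fin I.n) : ℕ :=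
  if I.T < 2 * I.width i then 2 * I.height i else if 7 * I.T < 16 * I.width i then I.height i else 0

/-- Double counting of the pairs of a task and a slot covered by it. -/
theorem sum_load_eq_area {S : Finset (Fin I.n)} {A : Fin I.n → ℕ}
    (h : ∀ i ∈ S, A i + I.width i ≤ I.T) :
    ∑ t ∈ Finset.range I.T, I.load S A t = I.area S := by
  unfold load area
  simp_rw [Finset.sum_filter]
  rw [Finset.sum_comm]
  refine Finset.sum_congr rfl fun i hi => ?_
  rw [← Finset.sum_filter, Finset.sum_const, smul_eq_mul, mul_comm]
  congr 1
  have : (Finset.range I.T).filter (fun t => A i ≤ t ∧ t < A i + I.width i)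
      = Finset.Ico (A i) (A i + I.width i) := by
    ext t
    have := h i hi
    simp only [Finset.mem_filter, Finset.mem_range, Finset.mem_Ico]
    omega
  rw [this]
  simp

theorem FeasibleAllocation.area_le {S : Finset (Fin I.n)} {A : Fin I.n → ℕ}
    (h : I.FeasibleAllocation S A) : I.area S ≤ I.T * I.C := by
  rw [← sum_load_eq_area h.1]
  calc _ ≤ ∑ t ∈ Finset.range I.T, I.C :=
        Finset.sum_le_sum fun t ht => h.2 t (Finset.mem_range.1 ht)
    _ = I.T * I.C := by simp

theorem FeasibleAllocation.sum_weight_le {S : Finset (Fin I.n)} {A : Fin I.n → ℕ}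
    (h : I.FeasibleAllocation S A) : ∑ i ∈ S, I.weight i ≤ 3 * I.C := by
  rcases Nat.eq_zero_or_pos I.T with hT | hT
  · refine le_trans (le_of_eq (Finset.sum_eq_zero fun i hi => ?_)) (Nat.zero_le _)
    have := h.1 i hi
    simp only [weight]
    rw [if_neg (by omega), if_neg (by omega)]
  -- Three probe slots suffice: a task wider than `T/2` covers the middle one and one of the outer
  -- two, and a task wider than `7T/16 ≥ T/3` covers at least one of the three.
  have h₁ := h.2 (I.T / 3) (by omega)
  have h₂ := h.2 (2 * I.T / 3) (by omega)
  have h₃ := h.2 (I.T / 2) (by omega)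
  suffices ∑ i ∈ S, I.weight i ≤
      I.load S A (I.T / 3) + I.load S A (2 * I.T / 3) + I.load S A (I.T / 2) by omega
  simp only [load, Finset.sum_filter, ← Finset.sum_add_distrib]
  refine Finset.sum_le_sum fun i hi => ?_
  have := h.1 i hi
  simp only [weight]
  split_ifs <;> omega

/-- Turns a bound per bin into a lower bound on the number of bins; it serves for both area and
weight. -/
theorem Solution.Feasible.sum_le {s : I.Solution} (hs : s.Feasible) {f : Fin I.n → ℕ} {b : ℕ}
    (hf : ∀ S A, I.FeasibleAllocation S A → ∑ i ∈ S, f i ≤ b) : ∑ i, f i ≤ s.bins * b := by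
  rw [← Finset.sum_fiberwise_of_maps_to (s := Finset.univ) (t := Finset.range s.bins) (g := s.bin)
    (fun i _ => Finset.mem_range.2 (hs.1 i))]
  calc _ ≤ ∑ _j ∈ Finset.range s.bins, b :=
        Finset.sum_le_sum fun j hj => hf _ _ (hs.2 j (Finset.mem_range.1 hj))
    _ = _ := by simp

/-! ### Partial packings -/

/-- A partial packing: `bin i` is `0` for the tasks that are not packed yet, and the bins are
numbered from `1` on; `finish i` is the first slot after task `i`. -/
structure Packing (I : Instance) where
  bins : ℕ
  bin : Fin I.n → ℕ
  start : Fin I.n → ℕ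
  finish : Fin I.n → ℕ

namespace Packing

variable (c : I.Packing)

/-- The tasks in bin `j`. -/
def tasks (j : ℕ) : Finset (Fin I.n) := {i | c.bin i = j}

variable {c} in
theorem mem_tasks {j : ℕ} {i : Fin I.n} : i ∈ c.tasks j ↔ c.bin i = j := by
  simp [tasks]

/-- The total height of the tasks in bin `j` that end after slot `t`. -/
def late (j t : ℕ) : ℕ := ∑ i, if c.bin i = j ∧ t < c.finish i then I.height i else 0

/-- The empty packing. -/
def empty (I : Instance) : I.Packing := ⟨0, fun _ => 0, fun _ => 0, fun _ => 0⟩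

/-- Task `z` is put into bin `j` from slot `x` on. -/
def insert (z : Fin I.n) (j x : ℕ) : I.Packing where
  bins := max c.bins j
  bin := Function.update c.bin z j
  start := Function.update c.start z x
  finish := Function.update c.finish z (x + I.width z)

/-- Slot `x` is the first one from which on there is room for height `h` in bin `j`. -/
def IsFirstRoom (j h x : ℕ) : Prop :=
  c.late j x + h ≤ I.C ∧ ∀ t < x, I.C < c.late j t + h

/-- In bin `j`, the tasks have been started in a nearly full stretch of slots `0, …, p`. -/
structure GoodBin (j p : ℕ) : Prop where
  start_le : ∀ i, c.bin i = j → c.start i ≤ p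
  lt_late : ∀ t < p, I.C < c.late j t
  lt_load : ∀ t < p, 8 * I.C < 9 * I.load (c.tasks j) c.start t
  load_le : ∀ t, I.load (c.tasks j) c.start t ≤ I.C

/-- The invariant of the first fit algorithm. -/
structure Good : Prop where
  bin_le : ∀ i, c.bin i ≤ c.bins
  finish_eq : ∀ i, c.bin i ≠ 0 → c.finish i = c.start i + I.width i
  finish_le : ∀ i, c.finish i ≤ I.T
  finish_zero : ∀ i, c.bin i = 0 → c.finish i = 0
  bins_le_card : c.bins ≤ (Finset.univ.filter fun i => c.bin i ≠ 0).card
  bins_le_opt : c.bins ≤ 2 * I.OPT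
  goodBin : ∀ j, 0 < j → ∃ p, c.GoodBin j p

theorem good_empty (I : Instance) : (empty I).Good where
  bin_le _ := le_rfl
  finish_eq _ h := absurd rfl h
  finish_le _ := Nat.zero_le _
  finish_zero _ _ := rfl
  bins_le_card := Nat.zero_le _
  bins_le_opt := Nat.zero_le _
  goodBin j hj := by
    refine ⟨0, ⟨fun i _ => le_rfl, fun t ht => absurd ht (by omega), fun t ht => absurd ht (by omega),
      fun t => ?_⟩⟩
    have : (empty I).tasks j = ∅ := by
      ext i
      rw [mem_tasks]
      simp only [empty, Finset.notMem_empty, iff_false]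
      omega
    simp [this, load]

variable {c}

/-! ### The load profile of a bin and its change under an insertion. -/

theorem late_anti {j t u : ℕ} (h : t ≤ u) : c.late j u ≤ c.late j t := by
  refine Finset.sum_le_sum fun i _ => ?_
  split_ifs <;> omega

theorem load_eq (j t : ℕ) : I.load (c.tasks j) c.start t =
    ∑ i, if c.bin i = j ∧ c.start i ≤ t ∧ t < c.start i + I.width i then I.height i else 0 := by
  simp only [load, tasks, Finset.sum_filter, ← ite_and]

theorem late_insert {z : Fin I.n} (hz : c.bin z = 0) {j : ℕ} (hj : 0 < j) (x t : ℕ) :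
    (c.insert z j x).late j t = c.late j t + if t < x + I.width z then I.height z else 0 := by
  unfold late
  rw [← Finset.add_sum_erase _ _ (Finset.mem_univ z), ← Finset.add_sum_erase (a := z) _
    (fun i => if c.bin i = j ∧ t < c.finish i then I.height i else 0) (Finset.mem_univ z)]
  have h₀ : ¬ (c.bin z = j ∧ t < c.finish z) := by omega
  rw [if_neg h₀, zero_add, add_comm]
  congr 1
  · refine Finset.sum_congr rfl fun i hi => ?_
    have hi := Finset.ne_of_mem_erase hi
    simp [insert, hi]
  · simp [insert]

theorem load_insert {z : Fin I.n} (hz : c.bin z = 0) {j : ℕ} (hj : 0 < j) (x t : ℕ) :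
    I.load ((c.insert z j x).tasks j) (c.insert z j x).start t =
      I.load (c.tasks j) c.start t +
        if x ≤ t ∧ t < x + I.width z then I.height z else 0 := by
  rw [load_eq, load_eq]
  rw [← Finset.add_sum_erase _ _ (Finset.mem_univ z), ← Finset.add_sum_erase (a := z) _
    (fun i => if c.bin i = j ∧ c.start i ≤ t ∧ t < c.start i + I.width i then I.height i else 0)
    (Finset.mem_univ z)]
  have h₀ : ¬ (c.bin z = j ∧ c.start z ≤ t ∧ t < c.start z + I.width z) := by omega
  rw [if_neg h₀, zero_add, add_comm]
  congr 1
  · refine Finset.sum_congr rfl fun i hi => ?_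
    have hi := Finset.ne_of_mem_erase hi
    simp [insert, hi]
  · simp [insert]

theorem tasks_insert_of_ne {z : Fin I.n} (hz : c.bin z = 0) {j j' : ℕ} (hj' : 0 < j')
    (h : j' ≠ j) (x : ℕ) : (c.insert z j x).tasks j' = c.tasks j' := by
  ext i
  rw [mem_tasks, mem_tasks]
  by_cases hi : i = z
  · subst hi
    simp only [insert, Function.update_self]
    omega
  · simp [insert, hi]

theorem Good.load_le_late (hc : c.Good) {j : ℕ} (hj : 0 < j) (t : ℕ) :
    I.load (c.tasks j) c.start t ≤ c.late j t := by
  rw [load_eq]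
  refine Finset.sum_le_sum fun i _ => ?_
  by_cases hi : c.bin i = j
  · have := hc.finish_eq i (by omega)
    split_ifs <;> omega
  · simp [hi]

/-- From slot `p` on every task of the bin has started, so being late and being active are the same.
-/
theorem Good.load_eq_late (hc : c.Good) {j p t : ℕ} (hj : 0 < j) (hp : c.GoodBin j p)
    (ht : p ≤ t) : I.load (c.tasks j) c.start t = c.late j t := by
  rw [load_eq]
  refine Finset.sum_congr rfl fun i _ => ?_
  by_cases hi : c.bin i = j
  · have := hc.finish_eq i (by omega)
    have := hp.start_le i hi
    split_ifs <;> omega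
  · simp [hi]

/-- Up to the first slot with room, a bin is nearly full. -/
theorem Good.lt_load (hc : c.Good) (hh : I.Short) {z : Fin I.n} {j x t : ℕ} (hj : 0 < j)
    (hx : c.IsFirstRoom j (I.height z) x) (ht : t < x) :
    8 * I.C < 9 * I.load (c.tasks j) c.start t := by
  obtain ⟨p, hp⟩ := hc.goodBin j hj
  by_cases htp : t < p
  · exact hp.lt_load t htp
  · rw [hc.load_eq_late hj hp (by omega)]
    have := hx.2 t ht
    have := hh z
    omega

theorem Good.goodBin_insert (hc : c.Good) (hh : I.Short) {z : Fin I.n} (hz : c.bin z = 0)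
    {j x : ℕ} (hj : 0 < j) (hx : c.IsFirstRoom j (I.height z) x) :
    (c.insert z j x).GoodBin j x := by
  obtain ⟨p, hp⟩ := hc.goodBin j hj
  -- First-room slots never move back, even for a less high task: before `p` the late height alone
  -- exceeds `C`. Hence `x` can replace `p`.
  have hpx : p ≤ x := by
    by_contra h
    have := hp.lt_late x (by omega)
    have := hx.1
    omega
  constructor
  · intro i hi
    by_cases hiz : i = z
    · simp [insert, hiz]
    · simp only [insert, ne_eq, hiz, not_false_eq_true, Function.update_of_ne] at hi ⊢
      exact (hp.start_le i hi).trans hpx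
  · intro t ht
    rw [late_insert hz hj, if_pos (by omega)]
    exact hx.2 t ht
  · intro t ht
    rw [load_insert hz hj, if_neg (by omega)]
    exact hc.lt_load hh hj hx ht
  · intro t
    rw [load_insert hz hj]
    have h₁ := hp.load_le t
    split_ifs with h
    -- From `x` on, the old load is at most the late height at `t`, which is at most that at `x`,
    -- where there is room for `z`.
    · have h₂ := hc.load_le_late hj t
      have h₃ := late_anti (c := c) (j := j) h.1
      have := hx.1
      omega
    · simpa using h₁

theorem GoodBin.insert_of_ne {z : Fin I.n} (hz : c.bin z = 0) {j j' p : ℕ} (hj' : 0 < j')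
    (h : j' ≠ j) (x : ℕ) (hp : c.GoodBin j' p) : (c.insert z j x).GoodBin j' p := by
  have hload : ∀ t, I.load ((c.insert z j x).tasks j') (c.insert z j x).start t =
      I.load (c.tasks j') c.start t := by
    intro t
    rw [tasks_insert_of_ne hz hj' h]
    unfold load
    rw [Finset.sum_filter, Finset.sum_filter]
    refine Finset.sum_congr rfl fun i hi => ?_
    have : i ≠ z := by
      rintro rfl
      rw [mem_tasks] at hi
      omega
    simp [insert, this]
  have hne : ∀ i, (c.insert z j x).bin i = j' → i ≠ z ∧ c.bin i = j' := by
    intro i hi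
    by_cases hiz : i = z
    · subst hiz
      simp [insert] at hi
      omega
    · simpa [insert, hiz] using hi
  constructor
  · intro i hi
    obtain ⟨hiz, hi⟩ := hne i hi
    simpa [insert, hiz] using hp.start_le i hi
  · intro t ht
    refine (hp.lt_late t ht).trans_le (Finset.sum_le_sum fun i _ => ?_)
    by_cases hiz : i = z
    · subst hiz
      rw [if_neg (by omega)]
      exact Nat.zero_le _
    · simp [insert, hiz]
  · intro t ht
    rw [hload]
    exact hp.lt_load t ht
  · intro t
    rw [hload]
    exact hp.load_le t

/-- A bin that has no room for a task of width at most `7T/16` has more than half of its area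
covered. -/
theorem Good.lt_area (hc : c.Good) {j w : ℕ} (hj : 0 < j) (hw : 16 * w ≤ 7 * I.T) (hw0 : 0 < w)
    (hl : ∀ t, t + w ≤ I.T → 8 * I.C < 9 * I.load (c.tasks j) c.start t) :
    I.T * I.C < 2 * I.area (c.tasks j) := by
  have h : ∀ i ∈ c.tasks j, c.start i + I.width i ≤ I.T := by
    intro i hi
    rw [mem_tasks] at hi
    rw [← hc.finish_eq i (by omega)]
    exact hc.finish_le i
  -- Only the slots `0, …, T - w` are counted; `0 < w` keeps them inside the timeline.
  have h₁ : (I.T - w + 1) * (8 * I.C + 1) ≤ 9 * I.area (c.tasks j) := by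
    rw [← sum_load_eq_area h, Finset.mul_sum]
    calc (I.T - w + 1) * (8 * I.C + 1)
        = ∑ _t ∈ Finset.range (I.T - w + 1), (8 * I.C + 1) := by simp
      _ ≤ ∑ t ∈ Finset.range (I.T - w + 1), 9 * I.load (c.tasks j) c.start t :=
          Finset.sum_le_sum fun t ht => hl t (by simp at ht; omega)
      _ ≤ _ := Finset.sum_le_sum_of_subset (by
          intro t ht
          simp at ht ⊢
          omega)
  obtain ⟨d, hd⟩ : ∃ d, I.T = w + d := ⟨I.T - w, by omega⟩
  have h₂ : I.T - w = d := by omega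
  rw [h₂] at h₁
  have h₃ : 9 * I.T ≤ 16 * d := by omega
  have h₄ := Nat.mul_le_mul_right I.C h₃
  nlinarith

/-- A bin that contains only tasks at least as wide as a task of width more than `7T/16` for which
there is no room has large weight. -/
theorem Good.lt_sum_weight (hc : c.Good) {j w : ℕ} (hj : 0 < j) (hwT : w ≤ I.T) (hcls : ∀ i, c.bin i = j → 7 * I.T < 16 * I.width i)
    (hwide : I.T < 2 * w → ∀ i, c.bin i = j → I.T < 2 * I.width i)
    (hl : ∀ t, t + w ≤ I.T → 8 * I.C < 9 * I.load (c.tasks j) c.start t) :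
    16 * I.C < 9 * ∑ i ∈ c.tasks j, I.weight i := by
  have h₀ := hl 0 (by omega)
  have h₁ := hl (I.T - w) (by omega)
  -- If `w > T/2`, all tasks have weight twice their height and slot `0` may be counted twice.
  -- Otherwise a task of width at most `T/2 ≤ T - w` that covers slot `0` misses slot `T - w`, so
  -- its single height pays for both.
  suffices I.load (c.tasks j) c.start 0 + I.load (c.tasks j) c.start
      (if I.T < 2 * w then 0 else I.T - w) ≤ ∑ i ∈ c.tasks j, I.weight i by
    split_ifs at this <;> omega
  simp only [load, Finset.sum_filter, ← Finset.sum_add_distrib]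
  refine Finset.sum_le_sum fun i hi => ?_
  rw [mem_tasks] at hi
  have h₂ := hcls i hi
  have h₃ := fun h => hwide h i hi
  have h₄ := hc.finish_eq i (by omega)
  have h₅ := hc.finish_le i
  simp only [weight]
  by_cases hw2 : I.T < 2 * w
  · have := h₃ hw2
    simp only [hw2, if_true, this]
    split_ifs <;> omega
  · simp only [hw2, if_false, h₂, if_true]
    split_ifs <;> omega

/-! ### Comparison with the optimum and preservation of the invariant. -/

theorem sum_sum_tasks_le (f : Fin I.n → ℕ) (k : ℕ) :
    ∑ j ∈ Finset.Icc 1 k, ∑ i ∈ c.tasks j, f i ≤ ∑ i, f i := by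
  unfold tasks
  simp_rw [Finset.sum_filter]
  rw [Finset.sum_comm]
  refine Finset.sum_le_sum fun i _ => ?_
  rw [Finset.sum_ite_eq]
  split_ifs <;> simp

/-- If there is no room for a task in any of the bins, then there are fewer than `2 * OPT` bins. -/
theorem Good.bins_lt (hc : c.Good) (hw : I.WidthsFit) (hh : I.Short) {z : Fin I.n}
    (hcls : ∀ i, c.bin i ≠ 0 → (7 * I.T < 16 * I.width z → 7 * I.T < 16 * I.width i) ∧
      (I.T < 2 * I.width z → I.T < 2 * I.width i))
    (hfail : ∀ j, 0 < j → j ≤ c.bins → ∃ x, c.IsFirstRoom j (I.height z) x ∧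
      I.T < x + I.width z) :
    c.bins < 2 * I.OPT := by
  obtain ⟨s, hs, hm⟩ := I.exists_feasible_bins_eq_OPT hw hh
  rw [← hm]
  by_contra hlt
  have hs0 : 0 < s.bins := (Nat.zero_le _).trans_lt (hs.1 z)
  have hl : ∀ j, 0 < j → j ≤ c.bins → ∀ t, t + I.width z ≤ I.T →
      8 * I.C < 9 * I.load (c.tasks j) c.start t := by
    intro j hj hjk t ht
    obtain ⟨x, hx, hxT⟩ := hfail j hj hjk
    exact hc.lt_load hh hj hx (by omega)
  -- A task of width `0` is never refused: at slot `T` nothing is late, so the first slot with room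
  -- is at most `T`.
  have hw0 : 0 < I.width z := by
    by_contra h0
    obtain ⟨x, hx, hxT⟩ := hfail 1 one_pos (by omega)
    have h₁ := hx.2 I.T (by omega)
    have h₂ : c.late 1 I.T = 0 := by
      refine Finset.sum_eq_zero fun i _ => ?_
      rw [if_neg]
      have := hc.finish_le i
      omega
    have := hh z
    omega
  -- The summand `a + 1` keeps the strictness of the bound per bin, which is needed for the area and
  -- for `C = 0`.
  have key : ∀ (f : Fin I.n → ℕ) (a b : ℕ), (∀ j, 0 < j → j ≤ c.bins →
      a < b * ∑ i ∈ c.tasks j, f i) → c.bins * (a + 1) ≤ b * ∑ i, f i := by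
    intro f a b h
    calc c.bins * (a + 1) = ∑ _j ∈ Finset.Icc 1 c.bins, (a + 1) := by simp
      _ ≤ ∑ j ∈ Finset.Icc 1 c.bins, b * ∑ i ∈ c.tasks j, f i :=
          Finset.sum_le_sum fun j hj => h j (Finset.mem_Icc.1 hj).1 (Finset.mem_Icc.1 hj).2
      _ = b * ∑ j ∈ Finset.Icc 1 c.bins, ∑ i ∈ c.tasks j, f i := by rw [Finset.mul_sum]
      _ ≤ _ := Nat.mul_le_mul_left _ (sum_sum_tasks_le f _)
  by_cases hn : 16 * I.width z ≤ 7 * I.T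
  · have h₁ := key (fun i => I.height i * I.width i) (I.T * I.C) 2
      fun j hj hjk => hc.lt_area hj hn hw0 (hl j hj hjk)
    have h₂ := hs.sum_le (f := fun i => I.height i * I.width i) (b := I.T * I.C)
      fun S A h => h.area_le
    have h₃ := Nat.mul_le_mul_right (I.T * I.C + 1) (not_lt.1 hlt)
    nlinarith
  · have h₁ := key I.weight (16 * I.C) 9 fun j hj hjk =>
      hc.lt_sum_weight hj (hw z) (fun i hi => (hcls i (by omega)).1 (by omega))
        (fun h i hi => (hcls i (by omega)).2 h) (hl j hj hjk)
    have h₂ := hs.sum_le (f := I.weight) (b := 3 * I.C) fun S A h => h.sum_weight_le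
    have h₃ := Nat.mul_le_mul_right (16 * I.C + 1) (not_lt.1 hlt)
    -- With `m = s.bins > 0` this is `2m(16C + 1) ≤ 27mC`, which is impossible.
    nlinarith [Nat.zero_le (s.bins * I.C)]

theorem Good.insert (hc : c.Good) (hw : I.WidthsFit) (hh : I.Short) {z : Fin I.n}
    (hz : c.bin z = 0)
    (hcls : ∀ i, c.bin i ≠ 0 → (7 * I.T < 16 * I.width z → 7 * I.T < 16 * I.width i) ∧
      (I.T < 2 * I.width z → I.T < 2 * I.width i))
    {j x : ℕ} (hj : 0 < j) (hjk : j ≤ c.bins + 1)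
    (hfail : ∀ j', 0 < j' → j' < j → ∃ x, c.IsFirstRoom j' (I.height z) x ∧
      I.T < x + I.width z)
    (hx : c.IsFirstRoom j (I.height z) x) (hxT : x + I.width z ≤ I.T) :
    (c.insert z j x).Good where
  bin_le i := by
    by_cases hi : i = z
    · simp [Packing.insert, hi]
    · simpa [Packing.insert, hi] using Or.inl (hc.bin_le i)
  finish_eq i h := by
    by_cases hi : i = z
    · subst hi
      simp [Packing.insert]
    · simp only [Packing.insert, ne_eq, hi, not_false_eq_true, Function.update_of_ne] at h ⊢
      exact hc.finish_eq i h
  finish_le i := by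
    by_cases hi : i = z
    · subst hi
      simpa [Packing.insert] using hxT
    · simpa [Packing.insert, hi] using hc.finish_le i
  finish_zero i h := by
    by_cases hi : i = z
    · subst hi
      simp [Packing.insert] at h
      omega
    · simp only [Packing.insert, ne_eq, hi, not_false_eq_true, Function.update_of_ne] at h ⊢
      exact hc.finish_zero i h
  bins_le_card := by
    have h : (Finset.univ.filter fun i => (c.insert z j x).bin i ≠ 0) =
        Insert.insert z (Finset.univ.filter fun i => c.bin i ≠ 0) := by
      ext i
      rw [Finset.mem_insert, Finset.mem_filter, Finset.mem_filter]
      by_cases hi : i = z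
      · subst hi
        simp only [Packing.insert, Function.update_self, Finset.mem_univ, true_and, true_or,
          iff_true]
        omega
      · simp [Packing.insert, hi]
    rw [h, Finset.card_insert_of_notMem (by simp [hz])]
    have := hc.bins_le_card
    simp only [Packing.insert]
    omega
  bins_le_opt := by
    have := hc.bins_le_opt
    simp only [Packing.insert]
    -- The number of bins grows only if all open bins have refused `z`.
    by_cases h : j ≤ c.bins
    · omega
    · have := hc.bins_lt hw hh hcls fun j' h₁ h₂ => hfail j' h₁ (by omega)
      omega
  goodBin j' hj' := by
    by_cases h : j' = j
    · subst h
      exact ⟨x, hc.goodBin_insert hh hz hj hx⟩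
    · obtain ⟨p, hp⟩ := hc.goodBin j' hj'
      exact ⟨p, hp.insert_of_ne hz hj' h x⟩

/-- The first slot with room is `0` or the end of a task of the bin. -/
theorem IsFirstRoom.eq_finish {j h x : ℕ} (hx : c.IsFirstRoom j h x) :
    x = 0 ∨ ∃ i, c.finish i = x := by
  by_contra hcon
  push Not at hcon
  have h₁ := hx.2 (x - 1) (by omega)
  -- The late height drops only at the end of a task.
  have h₂ : c.late j (x - 1) = c.late j x := by
    refine Finset.sum_congr rfl fun i _ => ?_
    have := hcon.2 i
    split_ifs <;> omega
  have := hx.1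
  omega

theorem Good.exists_isFirstRoom (hc : c.Good) (j : ℕ) {h : ℕ} (hh : h ≤ I.C) :
    ∃ x ≤ I.T, c.IsFirstRoom j h x := by
  have hT : c.late j I.T + h ≤ I.C := by
    have : c.late j I.T = 0 := by
      refine Finset.sum_eq_zero fun i _ => ?_
      rw [if_neg]
      have := hc.finish_le i
      omega
    omega
  have hex : ∃ x, c.late j x + h ≤ I.C := ⟨I.T, hT⟩
  exact ⟨Nat.find hex, Nat.find_le hT, Nat.find_spec hex,
    fun t ht => not_le.1 (Nat.find_min hex ht)⟩

theorem Good.late_eq_zero (hc : c.Good) {j : ℕ} (hj : c.bins < j) (t : ℕ) : c.late j t = 0 := by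
  refine Finset.sum_eq_zero fun i _ => ?_
  have := hc.bin_le i
  rw [if_neg (by omega)]

/-- The solution that belongs to a packing of all tasks. -/
def toSolution (c : I.Packing) : I.Solution := ⟨c.bins, fun i => c.bin i - 1, c.start⟩

theorem Good.feasible_toSolution (hc : c.Good) (hall : ∀ i, c.bin i ≠ 0) :
    c.toSolution.Feasible := by
  refine ⟨fun i => ?_, fun j hj => ⟨fun i _ => ?_, fun t _ => ?_⟩⟩
  · have := hc.bin_le i
    have := hall i
    simp only [toSolution]
    omega
  · simp only [toSolution]
    rw [← hc.finish_eq i (hall i)]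
    exact hc.finish_le i
  · obtain ⟨p, hp⟩ := hc.goodBin (j + 1) (by omega)
    have : (Finset.univ.filter fun i => c.toSolution.bin i = j) = c.tasks (j + 1) := by
      ext i
      have := hall i
      rw [mem_tasks, Finset.mem_filter]
      simp only [toSolution, Finset.mem_univ, true_and]
      omega
    rw [this]
    exact hp.load_le t

end Packing

end Instance

/-! ### Total correctness with time bounds -/

/-- Started in `s`, the program `p` halts after at most `b` steps in a state that satisfies `Q`. -/
def Halts (p : Program) (s : State) (b : ℕ) (Q : State → Prop) : Prop :=
  ∃ k s', Runs p s k s' ∧ k ≤ b ∧ Q s'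

/-- The instruction writes neither to the memory nor to registers below `N`. -/
def Instr.Keeps (N : ℕ) : Instr → Prop
  | .const d _ => N ≤ d
  | .move d _ => N ≤ d
  | .add d _ _ => N ≤ d
  | .sub d _ _ => N ≤ d
  | .load d _ => N ≤ d
  | .store _ _ => False

/-- The program writes neither to the memory nor to registers below `N`. -/
def Program.Keeps (N : ℕ) : Program → Prop
  | .skip => True
  | .instr i => i.Keeps N
  | .seq p q => p.Keeps N ∧ q.Keeps N
  | .branch _ _ p q => p.Keeps N ∧ q.Keeps N
  | .loop _ _ p => p.Keeps N

/-- The states have the same memory and the same registers below `N`. -/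
def State.Agree (N : ℕ) (s s' : State) : Prop :=
  s'.mem = s.mem ∧ ∀ r < N, s'.reg r = s.reg r

theorem State.Agree.refl (N : ℕ) (s : State) : s.Agree N s := ⟨rfl, fun _ _ => rfl⟩

theorem State.Agree.trans {N : ℕ} {s s' s'' : State} (h : s.Agree N s') (h' : s'.Agree N s'') :
    s.Agree N s'' :=
  ⟨h'.1.trans h.1, fun r hr => (h'.2 r hr).trans (h.2 r hr)⟩

theorem State.Agree.mono {M N : ℕ} {s s' : State} (h : s.Agree N s') (hMN : M ≤ N) :
    s.Agree M s' :=
  ⟨h.1, fun r hr => h.2 r (hr.trans_le hMN)⟩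

theorem Instr.Keeps.agree {N : ℕ} {i : Instr} (h : i.Keeps N) (s : State) :
    s.Agree N (i.exec s) := by
  cases i <;> simp only [Instr.Keeps] at h <;>
    exact ⟨rfl, fun r hr => Function.update_of_ne (by omega) _ _⟩

/-- The frame rule: a syntactic check shows that a subprogram leaves its caller's registers and the
memory alone. -/
theorem Runs.agree {p : Program} {s s' : State} {k N : ℕ} (h : Runs p s k s') (hp : p.Keeps N) :
    s.Agree N s' := by
  induction h with
  | skip s => exact .refl _ _
  | instr i s => exact Instr.Keeps.agree hp s
  | seq _ _ ih ih' => exact (ih hp.1).trans (ih' hp.2)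
  | branch_true _ _ ih => exact ih hp.1
  | branch_false _ _ ih => exact ih hp.2
  | loop_true _ _ _ ih ih' => exact (ih hp).trans (ih' hp)
  | loop_false _ => exact .refl _ _

namespace Halts

variable {p q : Program} {s : State} {b b' : ℕ} {Q Q' : State → Prop}

theorem mono (h : Halts p s b Q) (hb : b ≤ b') (hQ : ∀ s', Q s' → Q' s') : Halts p s b' Q' := by
  obtain ⟨k, s', h₁, h₂, h₃⟩ := h
  exact ⟨k, s', h₁, h₂.trans hb, hQ _ h₃⟩

theorem and_agree {N : ℕ} (h : Halts p s b Q) (hp : p.Keeps N) :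
    Halts p s b fun s' => Q s' ∧ s.Agree N s' := by
  obtain ⟨k, s', h₁, h₂, h₃⟩ := h
  exact ⟨k, s', h₁, h₂, h₃, h₁.agree hp⟩

theorem skip (h : Q s) : Halts .skip s b Q := ⟨0, s, .skip s, Nat.zero_le _, h⟩

theorem instr {i : Instr} (h : Q (i.exec s)) : Halts (.instr i) s (b + 1) Q :=
  ⟨1, _, .instr i s, by omega, h⟩

theorem seq (h : Halts p s b fun s' => Halts q s' b' Q) : Halts (.seq p q) s (b + b') Q := by
  obtain ⟨k, s', h₁, h₂, l, s'', h₃, h₄, h₅⟩ := h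
  exact ⟨k + l, s'', .seq h₁ h₃, by omega, h₅⟩

theorem branch {x y : ℕ} (h₁ : s.reg x < s.reg y → Halts p s b Q)
    (h₂ : ¬ s.reg x < s.reg y → Halts q s b Q) : Halts (.branch x y p q) s (b + 1) Q := by
  by_cases h : s.reg x < s.reg y
  · obtain ⟨k, s', h₃, h₄, h₅⟩ := h₁ h
    exact ⟨k + 1, s', .branch_true h h₃, by omega, h₅⟩
  · obtain ⟨k, s', h₃, h₄, h₅⟩ := h₂ h
    exact ⟨k + 1, s', .branch_false h h₃, by omega, h₅⟩

/-- The rule for loops, with the difference of the compared registers as a variant. -/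
theorem loop {x y : ℕ} {Inv : State → Prop} (v : ℕ)
    (step : ∀ s, Inv s → s.reg x < s.reg y →
      Halts p s b fun s' => Inv s' ∧ s'.reg y - s'.reg x < s.reg y - s.reg x)
    (hs : Inv s) (hv : s.reg y - s.reg x ≤ v) :
    Halts (.loop x y p) s (v * (b + 1) + 1) fun s' => Inv s' ∧ ¬ s'.reg x < s'.reg y := by
  induction v generalizing s with
  | zero => exact ⟨1, s, .loop_false (by omega), by omega, hs, by omega⟩
  | succ v ih =>
    by_cases h : s.reg x < s.reg y
    · obtain ⟨k, s', h₁, h₂, h₃, h₄⟩ := step s hs h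
      obtain ⟨l, s'', h₅, h₆, h₇⟩ := ih h₃ (by omega)
      refine ⟨k + l + 1, s'', .loop_true h h₁ h₅, ?_, h₇⟩
      rw [Nat.succ_mul]
      omega
    · exact ⟨1, s, .loop_false h, by omega, hs, h⟩

/-- The rule for loops that do not change the memory and the registers below `N`. -/
theorem loop_agree {x y N : ℕ} {Inv : State → Prop} (v : ℕ) (hp : p.Keeps N)
    (step : ∀ s', s.Agree N s' → Inv s' → s'.reg x < s'.reg y →
      Halts p s' b fun s'' => Inv s'' ∧ s''.reg y - s''.reg x < s'.reg y - s'.reg x)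
    (hs : Inv s) (hv : s.reg y - s.reg x ≤ v) :
    Halts (.loop x y p) s (v * (b + 1) + 1) fun s' =>
      s.Agree N s' ∧ Inv s' ∧ ¬ s'.reg x < s'.reg y := by
  refine (loop (Inv := fun s' => s.Agree N s' ∧ Inv s') v ?_ ⟨.refl _ _, hs⟩ hv).mono le_rfl
    fun s' h => ⟨h.1.1, h.1.2, h.2⟩
  rintro s' ⟨h₁, h₂⟩ h₃
  exact ((step s' h₁ h₂ h₃).and_agree hp).mono le_rfl
    fun s'' h => ⟨⟨h₁.trans h.2, h.1.1⟩, h.1.2⟩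

end Halts

/-- A sequence of instructions. -/
def block : List Instr → Program
  | [] => .skip
  | i :: l => .seq (.instr i) (block l)

theorem Halts.block {l : List Instr} {s : State} {Q : State → Prop}
    (h : Q (l.foldl (fun s i => i.exec s) s)) : Halts (block l) s l.length Q := by
  induction l generalizing s with
  | nil => exact .skip h
  | cons i l ih =>
    rw [List.length_cons, add_comm]
    exact .seq (.instr (b := 0) (ih h))

/-! ### The program

Registers `0, …, 8` hold the constants `1`, `n`, `T`, `C` and the addresses of the heights, widths,
bins, starts and ends of the tasks; register `9` holds the number of bins. -/

open Program Instr

/-- Add the height of the task in register `30` to register `22` if the task lies in the bin in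
register `16` and ends after the slot in register `21`. -/
def lateBody : Program :=
  seq (block [add 31 6 30, load 31 31, add 32 8 30, load 32 32, add 33 4 30, load 33 33])
    (seq (branch 21 32 (branch 31 16 skip (branch 16 31 skip (instr (add 22 22 33)))) skip)
      (instr (add 30 30 0)))

/-- Compute in register `22` the total height of the tasks in the bin in register `16` that end
after the slot in register `21`. -/
def lateProg : Program :=
  seq (block [const 22 0, const 30 0]) (loop 30 1 lateBody)

/-- Compare the best slot so far with the end of the task in register `20`. -/
def roomBody : Program :=
  seq (block [add 21 8 20, load 21 21])
    (seq lateProg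
      (seq (instr (add 23 22 13))
        (seq (branch 3 23 skip (branch 21 18 (instr (move 18 21)) skip))
          (instr (add 20 20 0)))))

/-- Compute in register `18` the first slot from which on there is room for the height in register
`13` in the bin in register `16`. -/
def roomProg : Program :=
  seq (block [add 18 2 0, const 20 0]) (loop 20 1 roomBody)

/-- Check whether the task of height and width in registers `13` and `14` fits into the bin in
register `16`. -/
def fitBody : Program :=
  seq roomProg
    (seq (instr (add 19 18 14)) (branch 2 19 (instr (add 16 16 0)) (instr (move 17 16))))

/-- Find the first bin into which the task fits. -/
def fitProg : Program :=
  seq (block [const 16 1, add 17 9 0, add 17 17 0]) (loop 16 17 fitBody)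

/-- Put the task in register `12` into the first bin into which it fits. -/
def placeProg : Program :=
  seq fitProg
    (seq (block [add 15 6 12, store 15 16, add 15 7 12, store 15 18, add 15 8 12, store 15 19])
      (branch 9 16 (instr (move 9 16)) skip))

/-- Place the task in register `12` if its width belongs to the current range. -/
def passBody : Program :=
  seq (block [add 14 5 12, load 14 14, add 13 4 12, load 13 13, add 15 14 14, add 15 15 15,
      add 15 15 15, add 15 15 15])
    (seq (branch 15 10 skip (branch 15 11 placeProg skip)) (instr (add 12 12 0)))

/-- Place all tasks with 16 times the width at least register `10` and less than register `11`. -/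
def passProg : Program :=
  seq (block [const 12 0]) (loop 12 1 passBody)

/-- Write the bin and the start of the task in register `12` to the output. -/
def copyBody : Program :=
  block [add 13 6 12, load 13 13, sub 13 13 0, add 14 4 12, store 14 13,
    add 13 7 12, load 13 13, add 14 5 12, store 14 13, add 12 12 0]

/-- First fit in three passes: for the widths greater than `T/2`, for those between `7T/16` and
`T/2`, and for the remaining ones. -/
def firstFit : Program :=
  seq (block [const 0 1, const 1 2, load 1 1, const 2 0, load 2 2, const 3 1, load 3 3, const 4 3,
      add 5 4 1, add 6 5 1, add 7 6 1, add 8 7 1,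
      add 10 2 2, add 10 10 10, add 10 10 10, add 11 10 10, add 11 11 0, add 10 10 0])
    (seq passProg
      (seq (block [move 11 10, sub 10 10 2])
        (seq passProg
          (seq (block [move 11 10, const 10 0])
            (seq passProg
              (seq (block [const 10 0, store 10 9, const 4 1, add 5 4 1, const 12 0])
                (loop 12 1 copyBody)))))))

/-- Registers are allotted by nesting depth: fitting writes from `16` on, the search for room from
`18` on and the late height from `22` on, so inner loops spare the variables of outer ones. -/
theorem keeps_lateBody : lateBody.Keeps 22 := by
  simp [lateBody, Program.Keeps, Instr.Keeps, block]

theorem keeps_lateProg : lateProg.Keeps 22 := by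
  simp [lateProg, keeps_lateBody, Program.Keeps, Instr.Keeps, block]

theorem keeps_roomBody : roomBody.Keeps 18 := by
  have : lateProg.Keeps 18 := by
    simp [lateProg, lateBody, Program.Keeps, Instr.Keeps, block]
  simp [roomBody, this, Program.Keeps, Instr.Keeps, block]

theorem keeps_roomProg : roomProg.Keeps 18 := by
  simp [roomProg, keeps_roomBody, Program.Keeps, Instr.Keeps, block]

theorem keeps_fitProg : fitProg.Keeps 16 := by
  simp [fitProg, fitBody, roomProg, roomBody, lateProg, lateBody, Program.Keeps, Instr.Keeps, block]

theorem keeps_fitBody : fitBody.Keeps 16 := by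
  simp [fitBody, roomProg, roomBody, lateProg, lateBody, Program.Keeps, Instr.Keeps, block]

/-! ### Correctness of the subprograms -/

namespace Instance

/-- The state represents the partial packing `c`. -/
structure Rep (I : Instance) (c : I.Packing) (s : State) : Prop where
  one : s.reg 0 = 1
  num : s.reg 1 = I.n
  slots : s.reg 2 = I.T
  cap : s.reg 3 = I.C
  heights : s.reg 4 = 3
  widths : s.reg 5 = 3 + I.n
  binAddr : s.reg 6 = 3 + 2 * I.n
  startAddr : s.reg 7 = 3 + 3 * I.n
  finishAddr : s.reg 8 = 3 + 4 * I.n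
  bins : s.reg 9 = c.bins
  height : ∀ i : Fin I.n, s.mem (3 + i) = I.height i
  width : ∀ i : Fin I.n, s.mem (3 + I.n + i) = I.width i
  bin : ∀ i : Fin I.n, s.mem (3 + 2 * I.n + i) = c.bin i
  start : ∀ i : Fin I.n, s.mem (3 + 3 * I.n + i) = c.start i
  finish : ∀ i : Fin I.n, s.mem (3 + 4 * I.n + i) = c.finish i

variable {I : Instance} {c : I.Packing} {s s' : State}

theorem Rep.congr (h : I.Rep c s) (hs : s.Agree 10 s') : I.Rep c s' := by
  obtain ⟨hm, hr⟩ := hs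
  constructor
  all_goals first
    | (rw [hr _ (by norm_num)]; first
        | exact h.one | exact h.num | exact h.slots | exact h.cap | exact h.heights
        | exact h.widths | exact h.binAddr | exact h.startAddr | exact h.finishAddr
        | exact h.bins)
    | (rw [hm]; first
        | exact h.height | exact h.width | exact h.bin | exact h.start | exact h.finish)

end Instance

open Instance

variable {I : Instance} {c : I.Packing} {s : State}

theorem sum_lt_succ {n m : ℕ} (f : Fin n → ℕ) (h : m < n) :
    ∑ i : Fin n with i.val < m + 1, f i = (∑ i : Fin n with i.val < m, f i) + f ⟨m, h⟩ := by
  have : (Finset.univ.filter fun i : Fin n => i.val < m + 1) =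
      insert ⟨m, h⟩ (Finset.univ.filter fun i : Fin n => i.val < m) := by
    ext i
    simp [Fin.ext_iff]
    omega
  rw [this, Finset.sum_insert (by simp), add_comm]

theorem halts_lateProg (hs : I.Rep c s) :
    Halts lateProg s (2 + (I.n * (11 + 1) + 1)) fun s' =>
      s'.reg 22 = c.late (s.reg 16) (s.reg 21) ∧ s.Agree 22 s' := by
  refine Halts.and_agree ?_ keeps_lateProg
  set f : Fin I.n → ℕ := fun i =>
    if c.bin i = s.reg 16 ∧ s.reg 21 < c.finish i then I.height i else 0
  refine .seq (.block ?_)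
  simp only [List.foldl, Instr.exec]
  set s₁ : State := _
  change Halts _ s₁ _ _
  have h₁ : s.Agree 22 s₁ := ⟨rfl, fun r hr => by
    simp [s₁, show r ≠ 22 by omega, show r ≠ 30 by omega]⟩
  refine (Halts.loop_agree (N := 22) (Inv := fun s' => s'.reg 30 ≤ I.n ∧
    s'.reg 22 = ∑ i : Fin I.n with i.val < s'.reg 30, f i) I.n keeps_lateBody ?_ ?_ ?_).mono
    le_rfl ?_
  · rintro s₂ h₂ ⟨h₃, h₄⟩ h₅
    have hr := hs.congr ((h₁.trans h₂).mono (by norm_num))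
    have h16 : s₂.reg 16 = s.reg 16 := (h₁.trans h₂).2 _ (by norm_num)
    have h21 : s₂.reg 21 = s.reg 21 := (h₁.trans h₂).2 _ (by norm_num)
    have hlt : s₂.reg 30 < I.n := by rw [← hr.num]; exact h₅
    have hb := hr.bin ⟨_, hlt⟩
    have he := hr.finish ⟨_, hlt⟩
    have hh := hr.height ⟨_, hlt⟩
    simp only at hb he hh
    have hfv : f ⟨_, hlt⟩ = if c.bin ⟨_, hlt⟩ = s.reg 16 ∧ s.reg 21 < c.finish ⟨_, hlt⟩ then
      I.height ⟨_, hlt⟩ else 0 := rfl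
    have hn := hr.num
    have ho := hr.one
    refine Halts.mono (b := 6 + (4 + 1)) (.seq (.block ?_)) (by norm_num) (fun _ h => h)
    refine .seq (.branch (b := 3) (fun h₆ => .branch (b := 2) (fun h₇ => .skip (.instr (b := 0) ?_))
      (fun h₇ => .branch (b := 1) (fun h₈ => .skip (.instr (b := 0) ?_))
      fun h₈ => .instr (b := 0) (.instr (b := 0) ?_))) (fun h₆ => .skip (.instr (b := 0) ?_)))
    all_goals
      simp [Instr.exec, hr.binAddr, hr.finishAddr, hr.heights, hb, he, hh,
        h16, h21] at *
      simp only [hn, ho, h₄] at *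
      refine ⟨⟨by omega, ?_⟩, by omega⟩
      rw [sum_lt_succ f hlt, hfv]
      split_ifs <;> omega
  · simp [s₁]
  · have := hs.num
    simp [s₁, this]
  · rintro s₂ ⟨h₂, ⟨h₃, h₄⟩, h₅⟩
    have hr := hs.congr ((h₁.trans h₂).mono (by norm_num))
    rw [h₄]
    unfold Packing.late
    rw [Finset.filter_true_of_mem]
    intro i _
    have := hr.num
    omega

/-- The time bound for `lateProg`. -/
def lateTime (n : ℕ) : ℕ := 2 + (n * 12 + 1)

/-- The time bound for `roomProg`. -/
def roomTime (n : ℕ) : ℕ := 2 + (n * (lateTime n + 7 + 1) + 1)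

/-- The time bound for `fitProg`. -/
def fitTime (n : ℕ) : ℕ := 3 + ((n + 1) * (roomTime n + 3 + 1) + 1)

theorem halts_roomProg (hs : I.Rep c s) (hc : c.Good) {z : Fin I.n} (hz : c.bin z = 0)
    (hh : s.reg 13 ≤ I.C) :
    Halts roomProg s (roomTime I.n) fun s' =>
      c.IsFirstRoom (s.reg 16) (s.reg 13) (s'.reg 18) ∧ s.Agree 18 s' := by
  refine Halts.and_agree ?_ keeps_roomProg
  obtain ⟨x, hxT, hx⟩ := hc.exists_isFirstRoom (s.reg 16) hh
  -- Slot `0` needs no separate test: the unpacked task `z` itself has the default end `0`.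
  obtain ⟨i₀, hi₀⟩ : ∃ i, c.finish i = x := by
    rcases hx.eq_finish with h | h
    · exact ⟨z, by rw [h, hc.finish_zero z hz]⟩
    · exact h
  refine .seq (.block ?_)
  simp only [List.foldl, Instr.exec]
  set s₁ : State := _
  change Halts _ s₁ _ _
  have h₁ : s.Agree 18 s₁ := ⟨rfl, fun r hr => by
    simp [s₁, show r ≠ 18 by omega, show r ≠ 20 by omega]⟩
  -- Register `18` starts at `T + 1`, beyond every candidate, never drops below `x`, and equals `x`
  -- once a task ending there has been scanned.
  refine (Halts.loop_agree (N := 18) (Inv := fun s' => s'.reg 20 ≤ I.n ∧ x ≤ s'.reg 18 ∧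
    ∀ i : Fin I.n, i.val < s'.reg 20 → c.finish i = x → s'.reg 18 = x) I.n
    keeps_roomBody ?_ ?_ ?_).mono le_rfl ?_
  · rintro s₂ h₂ ⟨h₃, h₄, h₄'⟩ h₅
    have hr := hs.congr ((h₁.trans h₂).mono (by norm_num))
    have h16 : s₂.reg 16 = s.reg 16 := (h₁.trans h₂).2 _ (by norm_num)
    have h13 : s₂.reg 13 = s.reg 13 := (h₁.trans h₂).2 _ (by norm_num)
    have hlt : s₂.reg 20 < I.n := by rw [← hr.num]; exact h₅
    have he := hr.finish ⟨_, hlt⟩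
    simp only at he
    refine Halts.mono (b := 2 + (lateTime I.n + (1 + (3 + 1)))) (.seq (.block ?_)) (by omega)
      (fun _ h => h)
    simp only [List.foldl, Instr.exec]
    set s₃ : State := _
    change Halts _ s₃ _ _
    have h₃' : s₂.Agree 18 s₃ := ⟨rfl, fun r hr => by
      simp [s₃, show r ≠ 21 by omega]⟩
    have h320 : s₃.reg 20 = s₂.reg 20 := by simp [s₃]
    have h318 : s₃.reg 18 = s₂.reg 18 := by simp [s₃]
    have h321 : s₃.reg 21 = c.finish ⟨_, hlt⟩ := by simp [s₃, hr.finishAddr, he]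
    have hr₃ := hr.congr (h₃'.mono (by norm_num))
    refine .seq ((halts_lateProg hr₃).mono le_rfl ?_)
    rintro s₄ ⟨h22, h₄₃⟩
    have hr₄ := hr₃.congr (h₄₃.mono (by norm_num))
    have h420 : s₄.reg 20 = s₂.reg 20 := (h₄₃.2 _ (by norm_num)).trans h320
    have h418 : s₄.reg 18 = s₂.reg 18 := (h₄₃.2 _ (by norm_num)).trans h318
    have h421 : s₄.reg 21 = c.finish ⟨_, hlt⟩ := (h₄₃.2 _ (by norm_num)).trans h321
    have h413 : s₄.reg 13 = s.reg 13 :=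
      (h₄₃.2 _ (by norm_num)).trans ((h₃'.2 _ (by norm_num)).trans h13)
    have h416 : s₃.reg 16 = s.reg 16 := (h₃'.2 _ (by norm_num)).trans h16
    rw [h416, h321] at h22
    have hroom := hx.2 (c.finish ⟨_, hlt⟩)
    have hroom' := hx.1
    have hn := hr.num
    have hn₄ := hr₄.num
    have hcap := hr₄.cap
    have hone := hr₄.one
    have hsucc : ∀ i : Fin I.n, i.val < s₂.reg 20 + 1 → i.val < s₂.reg 20 ∨
        i = ⟨_, hlt⟩ := by
      intro i hi
      rw [Fin.ext_iff]
      simp only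
      omega
    refine .seq (.instr (b := 0) (.seq (.branch (b := 2)
      (fun h₆ => .skip (.instr (b := 0) ?_))
      (fun h₆ => .branch (b := 1) (fun h₇ => .instr (b := 0) (.instr (b := 0) ?_))
        fun h₇ => .skip (.instr (b := 0) ?_)))))
    · simp [Instr.exec, hone, h420, h418, hn₄, hn, hcap, h22, h413] at h₆ ⊢
      refine ⟨⟨by omega, h₄, fun i hi hix => ?_⟩, by omega⟩
      rcases hsucc i (by omega) with h | rfl
      · exact h₄' i h hix
      · rw [hix] at h₆
        omega
    · simp [Instr.exec, hone, h420, h418, hn₄, hn, hcap, h22, h413, h421] at h₆ h₇ ⊢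
      refine ⟨⟨by omega, by omega, fun i hi hix => ?_⟩, by omega⟩
      rcases hsucc i (by omega) with h | rfl
      · have := h₄' i h hix
        omega
      · exact hix
    · simp [Instr.exec, hone, h420, h418, hn₄, hn, hcap, h22, h413, h421] at h₆ h₇ ⊢
      refine ⟨⟨by omega, by omega, fun i hi hix => ?_⟩, by omega⟩
      rcases hsucc i (by omega) with h | rfl
      · exact h₄' i h hix
      · omega
  · have := hs.slots
    have := hs.one
    simp [s₁]
    omega
  · have := hs.num
    simp [s₁, this]
  · rintro s₂ ⟨h₂, ⟨h₃, h₄, h₄'⟩, h₅⟩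
    have hr := hs.congr ((h₁.trans h₂).mono (by norm_num))
    have := hr.num
    rw [h₄' i₀ (by omega) hi₀]
    exact hx

/-- Bounds the iterations of the search over bins. -/
theorem Instance.Packing.Good.bins_le (hc : c.Good) : c.bins ≤ I.n := by
  refine hc.bins_le_card.trans ((Finset.card_le_univ _).trans ?_)
  simp

theorem halts_fitProg (hs : I.Rep c s) (hc : c.Good) (hw : I.WidthsFit) (hh : I.Short)
    {z : Fin I.n} (hz : c.bin z = 0) (h13 : s.reg 13 = I.height z) (h14 : s.reg 14 = I.width z) :
    Halts fitProg s (fitTime I.n) fun s' =>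
      (0 < s'.reg 16 ∧ s'.reg 16 ≤ c.bins + 1 ∧
        (∀ j, 0 < j → j < s'.reg 16 → ∃ x, c.IsFirstRoom j (I.height z) x ∧
          I.T < x + I.width z) ∧
        c.IsFirstRoom (s'.reg 16) (I.height z) (s'.reg 18) ∧
        s'.reg 19 = s'.reg 18 + I.width z ∧ s'.reg 18 + I.width z ≤ I.T) ∧ s.Agree 16 s' := by
  refine Halts.and_agree ?_ keeps_fitProg
  have hzC : I.height z ≤ I.C := by
    have := hh z
    omega
  refine .seq (.block ?_)
  simp only [List.foldl, Instr.exec]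
  set s₁ : State := _
  change Halts _ s₁ _ _
  have h₁ : s.Agree 16 s₁ := ⟨rfl, fun r hr => by
    simp [s₁, show r ≠ 16 by omega, show r ≠ 17 by omega]⟩
  have hbn := hc.bins_le
  -- Register `17` doubles as a flag: it is `c.bins + 2` during the search, and success sets it to
  -- register `16`, which ends the loop.
  refine (Halts.loop_agree (N := 16) (Inv := fun s' => 0 < s'.reg 16 ∧ s'.reg 16 ≤ c.bins + 1 ∧
    (∀ j, 0 < j → j < s'.reg 16 → ∃ x, c.IsFirstRoom j (I.height z) x ∧ I.T < x + I.width z) ∧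
    (s'.reg 17 = c.bins + 2 ∨ s'.reg 17 = s'.reg 16 ∧
      c.IsFirstRoom (s'.reg 16) (I.height z) (s'.reg 18) ∧
      s'.reg 19 = s'.reg 18 + I.width z ∧ s'.reg 18 + I.width z ≤ I.T)) (I.n + 1)
    keeps_fitBody ?_ ?_ ?_).mono le_rfl ?_
  · rintro s₂ h₂ ⟨h₃, h₄, h₅, h₆⟩ h₇
    have hr := hs.congr ((h₁.trans h₂).mono (by norm_num))
    have h213 : s₂.reg 13 = I.height z := ((h₁.trans h₂).2 _ (by norm_num)).trans h13
    have h214 : s₂.reg 14 = I.width z := ((h₁.trans h₂).2 _ (by norm_num)).trans h14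
    have h217 : s₂.reg 17 = c.bins + 2 := by omega
    refine Halts.mono (b := roomTime I.n + (1 + 2))
      (.seq ((halts_roomProg hr hc hz (by omega)).mono le_rfl ?_)) (by omega) (fun _ h => h)
    rintro s₃ ⟨hx, h₈⟩
    have hr₃ := hr.congr (h₈.mono (by norm_num))
    have h316 : s₃.reg 16 = s₂.reg 16 := h₈.2 _ (by norm_num)
    have h317 : s₃.reg 17 = s₂.reg 17 := h₈.2 _ (by norm_num)
    have h314 : s₃.reg 14 = I.width z := (h₈.2 _ (by norm_num)).trans h214
    rw [h213] at hx
    refine .seq (.instr (b := 0) (.branch (b := 1) (fun h₉ => .instr (b := 0) ?_)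
      (fun h₉ => .instr (b := 0) ?_)))
    · simp [Instr.exec, h314, hr₃.slots, hr₃.one, h316, h317, h217] at h₉ ⊢
      -- Bin `c.bins + 1` is empty, so its first room is slot `0` and the task fits there.
      have hle : s₂.reg 16 ≤ c.bins := by
        by_contra hgt
        have h0 := hc.late_eq_zero (j := s₂.reg 16) (by omega) 0
        have hw := hw z
        rcases Nat.eq_zero_or_pos (s₃.reg 18) with h | h
        · omega
        · have := hx.2 0 h
          omega
      refine ⟨⟨hle, fun j hj hjl => ?_⟩, by omega⟩
      by_cases hj2 : j < s₂.reg 16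
      · exact h₅ j hj hj2
      · obtain rfl : j = s₂.reg 16 := by omega
        exact ⟨_, hx, h₉⟩
    · simp [Instr.exec, h314, hr₃.slots, h316, h217] at h₉ ⊢
      exact ⟨⟨h₃, h₄, h₅, Or.inr ⟨hx, h₉⟩⟩, by omega⟩
  · have := hs.bins
    have := hs.one
    simp [s₁]
    refine ⟨fun j hj hj' => by omega, by omega⟩
  · have := hs.bins
    have := hs.one
    simp [s₁]
    omega
  · rintro s₂ ⟨h₂, ⟨h₃, h₄, h₅, h₆⟩, h₇⟩
    refine ⟨h₃, h₄, h₅, ?_⟩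
    rcases h₆ with h | h
    · omega
    · exact h.2

/-- The time bound for `placeProg`. -/
def placeTime (n : ℕ) : ℕ := fitTime n + 8

theorem halts_placeProg (hs : I.Rep c s) (hc : c.Good) (hw : I.WidthsFit) (hh : I.Short)
    {z : Fin I.n} (hz : c.bin z = 0) (h12 : s.reg 12 = z) (h13 : s.reg 13 = I.height z)
    (h14 : s.reg 14 = I.width z)
    (hcls : ∀ i, c.bin i ≠ 0 → (7 * I.T < 16 * I.width z → 7 * I.T < 16 * I.width i) ∧
      (I.T < 2 * I.width z → I.T < 2 * I.width i)) :
    Halts placeProg s (placeTime I.n) fun s' =>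
      ∃ c' : I.Packing, c'.Good ∧ I.Rep c' s' ∧ (∀ i, c'.bin i ≠ 0 ↔ c.bin i ≠ 0 ∨ i = z) ∧
        s'.reg 10 = s.reg 10 ∧ s'.reg 11 = s.reg 11 ∧ s'.reg 12 = s.reg 12 := by
  refine Halts.mono (b := fitTime I.n + (6 + 2))
    (.seq ((halts_fitProg hs hc hw hh hz h13 h14).mono le_rfl ?_)) (by rfl) (fun _ h => h)
  rintro s₁ ⟨⟨hj, hjk, hfail, hx, h19, hxT⟩, h₁⟩
  have hr := hs.congr (h₁.mono (by norm_num))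
  have hgood := hc.insert hw hh hz hcls hj hjk hfail hx hxT
  have h112 : s₁.reg 12 = z := (h₁.2 _ (by norm_num)).trans h12
  refine .seq (.block ?_)
  have hrep : ∀ s' : State, (∀ r < 9, s'.reg r = s₁.reg r) →
      s'.reg 9 = max (s₁.reg 9) (s₁.reg 16) →
      s'.mem = Function.update (Function.update (Function.update s₁.mem (3 + 2 * I.n + z)
        (s₁.reg 16)) (3 + 3 * I.n + z) (s₁.reg 18)) (3 + 4 * I.n + z) (s₁.reg 19) →
      I.Rep (c.insert z (s₁.reg 16) (s₁.reg 18)) s' := by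
    intro s' h₂ h₃ h₄
    have hzn := z.2
    constructor
    · rw [h₂ _ (by norm_num), hr.one]
    · rw [h₂ _ (by norm_num), hr.num]
    · rw [h₂ _ (by norm_num), hr.slots]
    · rw [h₂ _ (by norm_num), hr.cap]
    · rw [h₂ _ (by norm_num), hr.heights]
    · rw [h₂ _ (by norm_num), hr.widths]
    · rw [h₂ _ (by norm_num), hr.binAddr]
    · rw [h₂ _ (by norm_num), hr.startAddr]
    · rw [h₂ _ (by norm_num), hr.finishAddr]
    · rw [h₃, hr.bins]
      rfl
    all_goals
      intro i
      have hi := i.2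
      rw [h₄]
    · rw [Function.update_of_ne (by omega), Function.update_of_ne (by omega),
        Function.update_of_ne (by omega), hr.height]
    · rw [Function.update_of_ne (by omega), Function.update_of_ne (by omega),
        Function.update_of_ne (by omega), hr.width]
    · rw [Function.update_of_ne (by omega), Function.update_of_ne (by omega)]
      by_cases hiz : i = z
      · subst hiz
        simp [Packing.insert]
      · have : (i : ℕ) ≠ z := fun h => hiz (Fin.ext h)
        rw [Function.update_of_ne (by omega), hr.bin]
        simp [Packing.insert, hiz]
    · rw [Function.update_of_ne (by omega)]
      by_cases hiz : i = z
      · subst hiz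
        simp [Packing.insert]
      · have : (i : ℕ) ≠ z := fun h => hiz (Fin.ext h)
        rw [Function.update_of_ne (by omega), Function.update_of_ne (by omega), hr.start]
        simp [Packing.insert, hiz]
    · by_cases hiz : i = z
      · subst hiz
        simp [Packing.insert, h19]
      · have : (i : ℕ) ≠ z := fun h => hiz (Fin.ext h)
        rw [Function.update_of_ne (by omega), Function.update_of_ne (by omega),
          Function.update_of_ne (by omega), hr.finish]
        simp [Packing.insert, hiz]
  have hbin : ∀ i, (c.insert z (s₁.reg 16) (s₁.reg 18)).bin i ≠ 0 ↔ c.bin i ≠ 0 ∨ i = z := by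
    intro i
    by_cases hiz : i = z
    · subst hiz
      simp only [Packing.insert, Function.update_self, or_true, iff_true]
      omega
    · simp [Packing.insert, hiz]
  have h10 : s₁.reg 10 = s.reg 10 := h₁.2 _ (by norm_num)
  have h11 : s₁.reg 11 = s.reg 11 := h₁.2 _ (by norm_num)
  have h12' : s₁.reg 12 = s.reg 12 := h₁.2 _ (by norm_num)
  refine .branch (b := 1) (fun h₂ => .instr (b := 0) ⟨_, hgood, hrep _ ?_ ?_ ?_, hbin, ?_⟩)
    (fun h₂ => .skip ⟨_, hgood, hrep _ ?_ ?_ ?_, hbin, ?_⟩)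
  · intro r hr
    simp [Instr.exec, show r ≠ 15 by omega, show r ≠ 9 by omega]
  · simp [Instr.exec] at h₂ ⊢
    omega
  · simp [Instr.exec, hr.binAddr, hr.startAddr, hr.finishAddr, h112]
  · simp [Instr.exec, h10, h11, h12']
  · intro r hr
    simp [Instr.exec, show r ≠ 15 by omega]
  · simp [Instr.exec] at h₂ ⊢
    omega
  · simp [Instr.exec, hr.binAddr, hr.startAddr, hr.finishAddr, h112]
  · simp [Instr.exec, h10, h11, h12']

/-- The time bound for `passProg`. -/
def passTime (n : ℕ) : ℕ := 1 + (n * (placeTime n + 11 + 1) + 1)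

/-- By `hcls`, each task placed in the pass meets only tasks of its own class or a wider one; the
order within a class is irrelevant. -/
theorem halts_passProg (hs : I.Rep c s) (hc : c.Good) (hw : I.WidthsFit) (hh : I.Short)
    (hle : s.reg 10 ≤ s.reg 11) (hbin : ∀ i, c.bin i ≠ 0 ↔ s.reg 11 ≤ 16 * I.width i)
    (hcls : ∀ z i, 16 * I.width z < s.reg 11 → s.reg 10 ≤ 16 * I.width i →
      (7 * I.T < 16 * I.width z → 7 * I.T < 16 * I.width i) ∧
      (I.T < 2 * I.width z → I.T < 2 * I.width i)) :
    Halts passProg s (passTime I.n) fun s' =>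
      ∃ c' : I.Packing, c'.Good ∧ I.Rep c' s' ∧ (∀ i, c'.bin i ≠ 0 ↔ s.reg 10 ≤ 16 * I.width i) ∧
        s'.reg 10 = s.reg 10 := by
  refine .seq (.block ?_)
  simp only [List.foldl, Instr.exec]
  set s₁ : State := _
  change Halts _ s₁ _ _
  have h₁ : s.Agree 12 s₁ := ⟨rfl, fun r hr => by simp [s₁, show r ≠ 12 by omega]⟩
  refine (Halts.loop (Inv := fun s' => ∃ c' : I.Packing, c'.Good ∧ I.Rep c' s' ∧
    s'.reg 12 ≤ I.n ∧ (∀ i : Fin I.n, c'.bin i ≠ 0 ↔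
      s.reg 11 ≤ 16 * I.width i ∨ (i.val < s'.reg 12 ∧ s.reg 10 ≤ 16 * I.width i)) ∧
    s'.reg 10 = s.reg 10 ∧ s'.reg 11 = s.reg 11) I.n ?_ ?_ ?_).mono le_rfl ?_
  · rintro s₂ ⟨c₂, hc₂, hr₂, h₃, h₄, h10, h11⟩ h₅
    have hlt : s₂.reg 12 < I.n := by rw [← hr₂.num]; exact h₅
    obtain ⟨z, hz⟩ : ∃ z : Fin I.n, (z : ℕ) = s₂.reg 12 := ⟨⟨_, hlt⟩, rfl⟩
    have hwz := hr₂.width z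
    have hhz := hr₂.height z
    rw [hz] at hwz hhz
    refine Halts.mono (b := 8 + (placeTime I.n + 2 + 1)) (.seq (.block ?_)) (by omega)
      (fun _ h => h)
    simp only [List.foldl, Instr.exec]
    set s₃ : State := _
    change Halts _ s₃ _ _
    have h₆ : s₂.Agree 13 s₃ := ⟨rfl, fun r hr => by
      simp [s₃, show r ≠ 13 by omega, show r ≠ 14 by omega, show r ≠ 15 by omega]⟩
    have hr₃ := hr₂.congr (h₆.mono (by norm_num))
    have h310 : s₃.reg 10 = s.reg 10 := (h₆.2 _ (by norm_num)).trans h10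
    have h311 : s₃.reg 11 = s.reg 11 := (h₆.2 _ (by norm_num)).trans h11
    have h312 : s₃.reg 12 = s₂.reg 12 := h₆.2 _ (by norm_num)
    have h313 : s₃.reg 13 = I.height z := by simp [s₃, hr₂.heights, hhz]
    have h314 : s₃.reg 14 = I.width z := by simp [s₃, hr₂.widths, hwz]
    have h315 : s₃.reg 15 = 16 * I.width z := by
      simp [s₃, hr₂.widths, hwz]
      omega
    -- Shared end of all three branches: the task is too narrow, placed now, or placed in an earlier
    -- pass.
    have finish : ∀ (s₄ : State) (c₄ : I.Packing), c₄.Good → I.Rep c₄ s₄ →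
        s₄.reg 10 = s.reg 10 → s₄.reg 11 = s.reg 11 → s₄.reg 12 = s₂.reg 12 →
        (∀ i, c₄.bin i ≠ 0 ↔ c₂.bin i ≠ 0 ∨
          (i = z ∧ s.reg 10 ≤ 16 * I.width z ∧ 16 * I.width z < s.reg 11)) →
        Halts (instr (add 12 12 0)) s₄ 1 fun s' => (∃ c' : I.Packing, c'.Good ∧ I.Rep c' s' ∧
          s'.reg 12 ≤ I.n ∧ (∀ i : Fin I.n, c'.bin i ≠ 0 ↔
            s.reg 11 ≤ 16 * I.width i ∨ (i.val < s'.reg 12 ∧ s.reg 10 ≤ 16 * I.width i)) ∧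
          s'.reg 10 = s.reg 10 ∧ s'.reg 11 = s.reg 11) ∧
          s'.reg 1 - s'.reg 12 < s₂.reg 1 - s₂.reg 12 := by
      intro s₄ c₄ hc₄ hr₄ h₇ h₈ h₉ hb
      have hn₄ := hr₄.num
      have hn₂ := hr₂.num
      have ho₄ := hr₄.one
      have hr₅ : I.Rep c₄ ((add 12 12 0).exec s₄) := hr₄.congr ⟨rfl, fun r hr => by
        simp [Instr.exec, show r ≠ 12 by omega]⟩
      refine .instr (b := 0) ⟨⟨c₄, hc₄, hr₅, ?_, ?_, ?_, ?_⟩, ?_⟩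
      · simp [Instr.exec]
        omega
      · intro i
        have : i = z ↔ i.val = s₂.reg 12 := by rw [Fin.ext_iff, hz]
        have h12' : ((add 12 12 0).exec s₄).reg 12 = s₂.reg 12 + 1 := by
          simp [Instr.exec, h₉, ho₄]
        rw [h12', hb i, h₄ i]
        by_cases hiz : i = z
        · subst hiz
          simp only [true_and]
          omega
        · simp only [hiz, false_and, or_false]
          have := fun h => hiz (this.2 h)
          omega
      · simp [Instr.exec, h₇]
      · simp [Instr.exec, h₈]
      · simp [Instr.exec]
        omega
    have hzbin : 16 * I.width z < s.reg 11 → c₂.bin z = 0 := by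
      intro h
      by_contra hne
      have := (h₄ z).1 hne
      omega
    refine .seq (.branch (b := placeTime I.n + 1) (fun h₇ => .skip ?_)
      (fun h₇ => .branch (b := placeTime I.n) (fun h₈ => ?_) (fun h₈ => .skip ?_)))
    · refine finish s₃ c₂ hc₂ hr₃ h310 h311 h312 fun i => ?_
      have : ¬ (i = z ∧ s.reg 10 ≤ 16 * I.width z ∧ 16 * I.width z < s.reg 11) := by omega
      simp only [this, or_false]
    · refine (halts_placeProg hr₃ hc₂ hw hh (hzbin (by omega)) (by rw [h312, hz]) h313 h314
        fun i hi => hcls z i (by omega) ?_).mono le_rfl ?_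
      · have := (h₄ i).1 hi
        omega
      · rintro s₄ ⟨c₄, hc₄, hr₄, hb, h10', h11', h12'⟩
        refine finish s₄ c₄ hc₄ hr₄ (h10'.trans h310) (h11'.trans h311) (h12'.trans h312)
          fun i => ?_
        rw [hb i]
        have : s.reg 10 ≤ 16 * I.width z ∧ 16 * I.width z < s.reg 11 := by omega
        simp only [this, and_true]
    · refine finish s₃ c₂ hc₂ hr₃ h310 h311 h312 fun i => ?_
      have : ¬ (i = z ∧ s.reg 10 ≤ 16 * I.width z ∧ 16 * I.width z < s.reg 11) := by omega
      simp only [this, or_false]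
  · refine ⟨c, hc, hs.congr (h₁.mono (by norm_num)), by simp [s₁], fun i => ?_, by simp [s₁],
      by simp [s₁]⟩
    rw [hbin i]
    simp [s₁]
  · have := hs.num
    simp [s₁, this]
  · rintro s₂ ⟨⟨c₂, hc₂, hr₂, h₃, h₄, h10, h11⟩, h₅⟩
    refine ⟨c₂, hc₂, hr₂, fun i => ?_, h10⟩
    rw [h₄ i]
    have := hr₂.num
    have := i.2
    omega

/-- The output occupies the addresses `0, …, 2n` and destroys input, but the bins and starts lie
from `3 + 2n` on. As `Rep` is lost, the invariant lists only what the copying needs. -/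
theorem halts_copy (hs : I.Rep c s) :
    Halts (seq (block [const 10 0, store 10 9, const 4 1, add 5 4 1, const 12 0])
      (loop 12 1 copyBody)) s (5 + (I.n * (10 + 1) + 1)) fun s' =>
        I.outputSolution s' = c.toSolution := by
  refine .seq (.block ?_)
  simp only [List.foldl, Instr.exec]
  set s₁ : State := _
  change Halts _ s₁ _ _
  refine (Halts.loop (Inv := fun s' => s'.reg 0 = 1 ∧ s'.reg 1 = I.n ∧ s'.reg 4 = 1 ∧
    s'.reg 5 = 1 + I.n ∧ s'.reg 6 = 3 + 2 * I.n ∧ s'.reg 7 = 3 + 3 * I.n ∧ s'.reg 12 ≤ I.n ∧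
    (∀ i : Fin I.n, s'.mem (3 + 2 * I.n + i) = c.bin i) ∧
    (∀ i : Fin I.n, s'.mem (3 + 3 * I.n + i) = c.start i) ∧ s'.mem 0 = c.bins ∧
    ∀ i : Fin I.n, i.val < s'.reg 12 → s'.mem (1 + i) = c.bin i - 1 ∧
      s'.mem (1 + I.n + i) = c.start i) I.n ?_ ?_ ?_).mono le_rfl ?_
  · rintro s₂ ⟨h0, h1, h4, h5, h6, h7, h12, hb, hst, hk, hout⟩ h₅
    have hlt : s₂.reg 12 < I.n := by omega
    obtain ⟨z, hz⟩ : ∃ z : Fin I.n, (z : ℕ) = s₂.reg 12 := ⟨⟨_, hlt⟩, rfl⟩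
    have hbz := hb z
    have hsz := hst z
    rw [hz] at hbz hsz
    refine .block ?_
    have hmem : ((List.foldl (fun s i => i.exec s) s₂ [add 13 6 12, load 13 13, sub 13 13 0,
        add 14 4 12, store 14 13, add 13 7 12, load 13 13, add 14 5 12, store 14 13,
        add 12 12 0]).mem = Function.update (Function.update s₂.mem (1 + s₂.reg 12) (c.bin z - 1))
        (1 + I.n + s₂.reg 12) (c.start z)) := by
      simp [Instr.exec, h0, h4, h5, h6, h7, hbz]
      rw [Function.update_of_ne (by omega), hsz]
    refine ⟨⟨?_, ?_, ?_, ?_, ?_, ?_, ?_, ?_, ?_, ?_, ?_⟩, ?_⟩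
    · simp [Instr.exec, h0]
    · simp [Instr.exec, h1]
    · simp [Instr.exec, h4]
    · simp [Instr.exec, h5]
    · simp [Instr.exec, h6]
    · simp [Instr.exec, h7]
    · simp [Instr.exec, h0]
      omega
    · intro i
      rw [hmem, Function.update_of_ne (by omega), Function.update_of_ne (by omega), hb]
    · intro i
      rw [hmem, Function.update_of_ne (by omega), Function.update_of_ne (by omega), hst]
    · rw [hmem, Function.update_of_ne (by omega), Function.update_of_ne (by omega), hk]
    · intro i hi
      have hi' : i.val < s₂.reg 12 + 1 := by simpa [Instr.exec, h0] using hi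
      have hin := i.2
      rw [hmem]
      by_cases hiz : i = z
      · subst hiz
        rw [Function.update_of_ne (by omega), hz]
        simp
      · have hne : i.val ≠ z := fun h => hiz (Fin.ext h)
        obtain ⟨h₁, h₂⟩ := hout i (by omega)
        rw [Function.update_of_ne (by omega), Function.update_of_ne (by omega),
          Function.update_of_ne (by omega), Function.update_of_ne (by omega)]
        exact ⟨h₁, h₂⟩
    · simp [Instr.exec, h0, h1]
      omega
  · refine ⟨?_, ?_, ?_, ?_, ?_, ?_, ?_, ?_, ?_, ?_, ?_⟩
    · simp [s₁, hs.one]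
    · simp [s₁, hs.num]
    · simp [s₁]
    · simp [s₁, hs.num]
    · simp [s₁, hs.binAddr]
    · simp [s₁, hs.startAddr]
    · simp [s₁]
    · intro i
      simp [s₁, hs.bin]
    · intro i
      simp [s₁, hs.start]
    · simp [s₁, hs.bins]
    · simp [s₁]
  · simp [s₁, hs.num]
  · rintro s₂ ⟨⟨h0, h1, h4, h5, h6, h7, h12, hb, hst, hk, hout⟩, h₅⟩
    have hall : ∀ i : Fin I.n, i.val < s₂.reg 12 := fun i => by
      have := i.2
      omega
    simp only [outputSolution, Packing.toSolution, Solution.mk.injEq]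
    exact ⟨hk, funext fun i => (hout i (hall i)).1, funext fun i => (hout i (hall i)).2⟩

/-! ### Initial state, assembly of the three passes and the polynomial bound. -/

theorem rep_of_initialState {s : State} (hmem : s.mem = I.initialState.mem) (h0 : s.reg 0 = 1)
    (h1 : s.reg 1 = I.n) (h2 : s.reg 2 = I.T) (h3 : s.reg 3 = I.C) (h4 : s.reg 4 = 3)
    (h5 : s.reg 5 = 3 + I.n) (h6 : s.reg 6 = 3 + 2 * I.n) (h7 : s.reg 7 = 3 + 3 * I.n)
    (h8 : s.reg 8 = 3 + 4 * I.n) (h9 : s.reg 9 = 0) : I.Rep (Packing.empty I) s := by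
  have hlen : I.inputList.length = 3 + 2 * I.n := by
    simp [inputList]
    omega
  -- The memory behind the input is zero, which already encodes the empty packing.
  have hzero : ∀ a, 3 + 2 * I.n ≤ a → s.mem a = 0 := by
    intro a ha
    rw [hmem]
    simp only [initialState]
    rw [List.getD_eq_default]
    omega
  refine ⟨h0, h1, h2, h3, h4, h5, h6, h7, h8, h9, fun i => ?_, fun i => ?_, fun i => ?_,
    fun i => ?_, fun i => ?_⟩
  · rw [hmem]
    simp only [initialState, inputList]
    rw [List.getD_append _ _ _ _ (by simp; omega), List.getD_append_right _ _ _ _ (by simp)]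
    simp
  · rw [hmem]
    simp only [initialState, inputList]
    rw [List.getD_append_right _ _ _ _ (by simp; omega)]
    have : 3 + I.n + i - ([I.T, I.C, I.n] ++ List.ofFn I.height).length = i := by
      simp
      omega
    rw [this]
    simp
  · exact hzero _ (by omega)
  · exact hzero _ (by omega)
  · exact hzero _ (by omega)

theorem Instance.n_le_inputSize (I : Instance) : I.n ≤ I.inputSize := by
  have h : I.inputList.length ≤ I.inputSize := by
    unfold inputSize
    rw [← List.length_map (fun x => Nat.size x + 1)]
    refine List.length_le_sum_of_one_le _ fun x hx => ?_
    simp only [List.mem_map] at hx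
    obtain ⟨y, _, rfl⟩ := hx
    omega
  refine le_trans ?_ h
  simp [inputList]
  omega

/-- The time bound for `firstFit`. -/
def firstFitTime (n : ℕ) : ℕ := 3 * passTime n + 11 * n + 28

theorem halts_firstFit (hw : I.WidthsFit) (hh : I.Short) :
    Halts firstFit I.initialState (firstFitTime I.n) fun s' =>
      (I.outputSolution s').Feasible ∧ (I.outputSolution s').bins ≤ 2 * I.OPT := by
  refine Halts.mono (b := 18 + (passTime I.n + (2 + (passTime I.n + (2 + (passTime I.n +
    (5 + (I.n * (10 + 1) + 1)))))))) (.seq (.block ?_)) (by unfold firstFitTime; omega)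
    (fun _ h => h)
  have m0 : I.initialState.mem 0 = I.T := by simp [initialState, inputList]
  have m1 : I.initialState.mem 1 = I.C := by simp [initialState, inputList]
  have m2 : I.initialState.mem 2 = I.n := by simp [initialState, inputList]
  simp only [List.foldl]
  set s₁ : State := _
  change Halts _ s₁ _ _
  have hr₁ : I.Rep (Packing.empty I) s₁ := by
    apply rep_of_initialState <;> simp [s₁, Instr.exec, m0, m1, m2] <;> first | rfl | omega
  -- `16w ≥ 8T + 1` means `w > T/2`, and no task reaches the upper threshold `16T + 1`, in
  -- accordance with the empty packing. Subtracting `T` later gives `7T + 1`, that is, `w > 7T/16`.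
  have h10 : s₁.reg 10 = 8 * I.T + 1 := by
    simp [s₁, Instr.exec, m0]
    omega
  have h11 : s₁.reg 11 = 16 * I.T + 1 := by
    simp [s₁, Instr.exec, m0]
    omega
  clear_value s₁
  refine .seq ((halts_passProg hr₁ (Packing.good_empty I) hw hh (by omega) (fun i => ?_)
    (fun z i _ _ => by omega)).mono le_rfl ?_)
  · have := hw i
    simp only [Packing.empty, ne_eq, not_true_eq_false, false_iff]
    omega
  rintro s₂ ⟨c₂, hc₂, hr₂, hb₂, h10₂⟩
  refine .seq (.block ?_)
  simp only [List.foldl]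
  set s₃ : State := _
  change Halts _ s₃ _ _
  have hr₃ : I.Rep c₂ s₃ := hr₂.congr ⟨rfl, fun r hr => by
    simp [s₃, Instr.exec, show r ≠ 10 by omega, show r ≠ 11 by omega]⟩
  have h10₃ : s₃.reg 10 = 7 * I.T + 1 := by
    simp [s₃, Instr.exec, hr₂.slots, h10₂, h10]
    omega
  have h11₃ : s₃.reg 11 = 8 * I.T + 1 := by simp [s₃, Instr.exec, h10₂, h10]
  clear_value s₃
  refine .seq ((halts_passProg hr₃ hc₂ hw hh (by omega) (fun i => ?_)
    (fun z i _ _ => by omega)).mono le_rfl ?_)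
  · rw [hb₂ i, h10, h11₃]
  rintro s₄ ⟨c₄, hc₄, hr₄, hb₄, h10₄⟩
  refine .seq (.block ?_)
  simp only [List.foldl]
  set s₅ : State := _
  change Halts _ s₅ _ _
  have hr₅ : I.Rep c₄ s₅ := hr₄.congr ⟨rfl, fun r hr => by
    simp [s₅, Instr.exec, show r ≠ 10 by omega, show r ≠ 11 by omega]⟩
  have h10₅ : s₅.reg 10 = 0 := by simp [s₅, Instr.exec]
  have h11₅ : s₅.reg 11 = 7 * I.T + 1 := by simp [s₅, Instr.exec, h10₄, h10₃]
  clear_value s₅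
  refine .seq ((halts_passProg hr₅ hc₄ hw hh (by omega) (fun i => ?_)
    (fun z i _ _ => by omega)).mono le_rfl ?_)
  · rw [hb₄ i, h10₃, h11₅]
  rintro s₆ ⟨c₆, hc₆, hr₆, hb₆, _⟩
  refine (halts_copy hr₆).mono le_rfl fun s₇ h₇ => ?_
  rw [h₇]
  exact ⟨hc₆.feasible_toSolution fun i => (hb₆ i).2 (by omega), hc₆.bins_le_opt⟩

/-- The polynomial repeats the nesting of the time bounds; its coefficients are natural numbers, so
it is monotone and `n` may be replaced by the input length. -/
theorem exists_firstFitTime_le : ∃ q : Polynomial ℕ, ∀ n m, n ≤ m → firstFitTime n ≤ q.eval m := by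
  refine ⟨3 * (1 + (.X * (3 + ((.X + 1) * (2 + (.X * (2 + (.X * 12 + 1) + 7 + 1) + 1) + 3 + 1) + 1)
    + 8 + 11 + 1) + 1)) + 11 * .X + 28, fun n m h => ?_⟩
  simp only [firstFitTime, passTime, placeTime, fitTime, roomTime, lateTime, Polynomial.eval_add,
    Polynomial.eval_mul, Polynomial.eval_X, Polynomial.eval_ofNat, Polynomial.eval_one]
  gcongr

end DemandBinPacking

theorem mainTheorem2 :
    ∃ p : DemandBinPacking.Program,
      DemandBinPacking.IsPolyTimeApprox 2 (fun I => I.WidthsFit ∧ I.Short) p := by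
  obtain ⟨q, hq⟩ := DemandBinPacking.exists_firstFitTime_le
  refine ⟨DemandBinPacking.firstFit, q, fun I hI => ?_⟩
  obtain ⟨k, s, h₁, h₂, h₃⟩ := DemandBinPacking.halts_firstFit hI.1 hI.2
  exact ⟨k, s, h₁, h₂.trans (hq _ _ I.n_le_inputSize), h₃⟩
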